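/- Let $n\ge 0$, $r\ge 1$, $0\le k\le n$ be integers and $\hat T=[-1,1]^n$. Let $\Sigma_k$ be the set of increasing maps $\sigma:\{1,\dots,k\}\to\{1,\dots,n\}$, and put $dx_\sigma=dx_{\sigma_1}\wedge\dots\wedge dx_{\sigma_k}$. For a multi-index $\alpha\in\mathbb N^n$ and $\sigma\in\Sigma_k$ let $\operatorname{cdeg}_r(x^\alpha dx_\sigma)$ be the number of indices $i$ in the range of $\sigma$ with $\alpha_i=r$, and define the spaces of differential $k$-forms on $\mathbb R^n$ $$\mathcal Q_r^-\Lambda^k=\operatorname{span}\{x^\alpha dx_\sigma:\ \alpha_i\le r\ (1\le i\le n),\ \operatorname{cdeg}_r(x^\alpha dx_\sigma)=0\},$$ $$\mathcal B_r\Lambda^k=\operatorname{span}\{x^\alpha dx_\sigma:\ \alpha_i\le r\ (1\le i\le n),\ \operatorname{cdeg}_r(x^\alpha dx_\sigma)>0\}.$$ Let $d$ be the exterior derivative and $\kappa$ the Koszul operator, $(\kappa u)_x=x\lrcorner u_x$ (with $\kappa=0$ on $0$-forms). Set $$\tilde{\mathcal Q}_r\Lambda^k=\mathcal Q_r^-\Lambda^k+d\kappa\,\mathcal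 B_r\Lambda^k,$$ and let $\tilde{\mathcal Q}_r\Lambda^k(\hat T)$ be the space of restrictions of these forms to $\hat T$. Let $N_r\subset\hat T$ be the set of points all of whose coordinates are nodes of the $(r+1)$-point Gauss--Lobatto quadrature rule on $[-1,1]$, i.e. are $\pm1$ or zeros in $(-1,1)$ of the derivative of the Legendre polynomial of degree $r$. For a $k$-form $v=\sum_{\sigma\in\Sigma_k}v_\sigma\,dx_\sigma$ on $\hat T$ let $$R_r(v)=\bigl(v_\sigma(\xi)\bigr)_{\sigma\in\Sigma_k,\ \xi\in N_r}$$ be the family of values of all its coefficients at all points of $N_r$. If $v\in\tilde{\mathcal Q}_r\Lambda^k(\hat T)$ and $R_r(v)=0$, then $v=0$. Moreover $N_r$ has exactly $(r+1)^n$ points, and $R_r$ restricts to a bijection from $\tilde{\mathcal Q}_r\Lambda^k(\hat T)$ onto the space of all real families indexed by $\Sigma_k\times N_r$; that is, these $\binom nk(r+1)^n$ evaluations are a unisolvent set of degrees of freedom for $\tilde{\mathcal Q}_r\Lambda^k(\hat T)$. -/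

import Mathlib

namespace CubicalForms

noncomputable section

/-- Alternating `k`-linear real-valued maps on `ℝⁿ`. -/
abbrev Alt (n k : ℕ) : Type := (Fin n → ℝ) [⋀^Fin k]→L[ℝ] ℝ

/-- Differential `k`-forms on `ℝⁿ` (arbitrary coefficients). -/
abbrev Form (n k : ℕ) : Type := (Fin n → ℝ) → Alt n k

/-- `Σ_k`: the increasing maps `{1, …, k} → {1, …, n}`. -/
abbrev Idx (n k : ℕ) : Type := Fin k ↪o Fin n

/-- `dx_σ = dx_{σ₁} ∧ ⋯ ∧ dx_{σ_k}`, i.e. `(t₁, …, t_k) ↦ det ((t_i)_{σ_j})`. -/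
def dx {n k : ℕ} (σ : Idx n k) : Alt n k :=
  { (Matrix.detRowAlternating (n := Fin k) (R := ℝ)).compLinearMap
      (LinearMap.funLeft ℝ ℝ σ) with
    cont := by
      change Continuous fun t : Fin k → Fin n → ℝ =>
        Matrix.det (Matrix.of fun i j => t i (σ j))
      exact Continuous.matrix_det (by fun_prop) }

theorem dx_apply {n k : ℕ} (σ : Idx n k) (t : Fin k → Fin n → ℝ) :
    dx σ t = Matrix.det (Matrix.of fun i j => t i (σ j)) := rfl

/-- The form monomial `x^α dx_σ`. -/
def formMonomial {n k : ℕ} (α : Fin n → ℕ) (σ : Idx n k) : Form n k :=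
  fun x => (∏ i, x i ^ α i) • dx σ

/-- The conforming `s`-degree of `x^α dx_σ`: the number of `i` in the range of `σ` with
`α i = s`. -/
def cdeg {n k : ℕ} (s : ℕ) (α : Fin n → ℕ) (σ : Idx n k) : ℕ :=
  (Finset.univ.filter fun j : Fin k => α (σ j) = s).card

/-- `𝒬_r⁻ Λ^k`. -/
def QMinus (n r k : ℕ) : Submodule ℝ (Form n k) :=
  Submodule.span ℝ
    {m | ∃ (α : Fin n → ℕ) (σ : Idx n k), (∀ i, α i ≤ r) ∧ cdeg r α σ = 0 ∧ m = formMonomial α σ}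

/-- `ℬ_r Λ^k`. -/
def B (n r k : ℕ) : Submodule ℝ (Form n k) :=
  Submodule.span ℝ
    {m | ∃ (α : Fin n → ℕ) (σ : Idx n k), (∀ i, α i ≤ r) ∧ 0 < cdeg r α σ ∧ m = formMonomial α σ}

/-- The Koszul operator: contraction with the position vector,
`(κ u)_x (t₁, …, t_k) = u_x (x, t₁, …, t_k)`. -/
def koszul {n k : ℕ} (u : Form n (k + 1)) : Form n k :=
  fun x => (u x).curryLeft x

/-- `d κ ℬ_r Λ^k`; `κ` vanishes on `0`-forms. (The image of `ℬ_r Λ^k` is already a subspace, since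
`d` is additive on smooth forms; the span only packages it as a `Submodule`.) -/
def dKoszulB (n r : ℕ) : (k : ℕ) → Submodule ℝ (Form n k)
  | 0 => ⊥
  | k + 1 => Submodule.span ℝ ((fun u : Form n (k + 1) => extDeriv (koszul u)) '' B n r (k + 1))

/-- The shape function space `𝒬̃_r Λ^k = 𝒬_r⁻ Λ^k + d κ ℬ_r Λ^k` on `ℝⁿ`. -/
def QTilde (n r k : ℕ) : Submodule ℝ (Form n k) :=
  QMinus n r k ⊔ dKoszulB n r k

/-- The reference cube `T̂ = [-1, 1]ⁿ`. -/
def cube (n : ℕ) : Set (Fin n → ℝ) := {x | ∀ i, x i ∈ Set.Icc (-1 : ℝ) 1}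

/-- `𝒬̃_r Λ^k (T̂)`: the restrictions to `T̂` of the forms in `𝒬̃_r Λ^k`. -/
def QTildeCube (n r k : ℕ) : Submodule ℝ (cube n → Alt n k) :=
  (QTilde n r k).map (LinearMap.funLeft ℝ (Alt n k) (Subtype.val : cube n → Fin n → ℝ))

/-- The Legendre polynomial of degree `r` (Rodrigues' formula). -/
def legendre (r : ℕ) : Polynomial ℝ :=
  Polynomial.C (1 / (2 ^ r * (r.factorial : ℝ))) *
    Polynomial.derivative^[r] ((Polynomial.X ^ 2 - 1) ^ r)

/-- The nodes of the `(r + 1)`-point Gauss–Lobatto rule on `[-1, 1]`, `r ≥ 1`: the two end points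
and the interior zeros of the derivative of the Legendre polynomial of degree `r`. -/
def gaussLobattoNodes (r : ℕ) : Set ℝ :=
  {-1, 1} ∪ {t | t ∈ Set.Ioo (-1 : ℝ) 1 ∧ (legendre r).derivative.eval t = 0}

/-- `N_r`: the tensor-product Gauss–Lobatto nodes in `T̂`. -/
def grid (n r : ℕ) : Set (cube n) := {x | ∀ i, x.1 i ∈ gaussLobattoNodes r}

/-- `R_r`: the values at the points of `N_r` of all the coefficients
`u_σ = u (e_{σ₁}, …, e_{σ_k})` of a `k`-form `u = ∑ u_σ dx_σ` on `T̂`. -/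
def nodalEval (n r k : ℕ) : (cube n → Alt n k) →ₗ[ℝ] (Idx n k → grid n r → ℝ) where
  toFun u := fun σ x => u x.1 fun j => Pi.single (σ j) 1
  map_add' _ _ := rfl
  map_smul' _ _ := rfl

end

end CubicalForms

/-! There are as many spanning shape functions (monomials of `𝒬_r⁻Λ^k`, and `dκ` of monomials of
`ℬ_rΛ^k`) as nodal values, namely `binom n k * (r + 1)^n`. It therefore suffices that a combination
vanishing on the grid has zero coefficients. Of the nodes, only their number `r + 1` and their lying
in `[-1, 1]` matter.

Take the part `Q + dκP` of highest total degree `d` of such a combination, with `Q` in `𝒬_r⁻Λ^k` and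
`P` in `ℬ_rΛ^k`; `dκ` preserves the degree. By the combinatorial Nullstellensatz
(`coeff_eq_zero_of_eval_grid`), `Q + dκP` contains no monomial with all partial degrees at most `r`.
The monomials of `P` are of this kind and do not occur in `Q`, so `P` is orthogonal to `dκP` for the
Fischer inner product. There `d` and `κ` are adjoint up to a positive factor (`sum_fischer_famD`),
whence `κP = 0`. Since `κ` is injective on `ℬ_rΛ^k` (`eq_zero_of_famK_eq_zero`), `P = 0`, and then
`Q = 0`. -/

namespace CubicalForms

noncomputable section

/-! ### Counting the Gauss–Lobatto nodes -/

open Polynomial in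
/-- Rolle's theorem for a polynomial with `m + 1` zeros in `[-1, 1]`. -/
theorem exists_finset_derivative_roots {p : ℝ[X]} {m : ℕ} {T : Finset ℝ}
    (hT : T.card = m + 1) (hI : ∀ t ∈ T, t ∈ Set.Icc (-1 : ℝ) 1) (hp : ∀ t ∈ T, p.eval t = 0) :
    ∃ S : Finset ℝ, S.card = m ∧
      ∀ t ∈ S, t ∈ Set.Ioo (-1 : ℝ) 1 ∧ p.derivative.eval t = 0 := by
  let f := T.orderEmbOfFin hT
  have hf : ∀ i, f i ∈ T := T.orderEmbOfFin_mem hT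
  have key : ∀ i : Fin m, ∃ c ∈ Set.Ioo (f i.castSucc) (f i.succ), p.derivative.eval c = 0 := by
    intro i
    obtain ⟨c, hc, h0⟩ := exists_deriv_eq_zero (f := fun x => p.eval x)
      (f.strictMono i.castSucc_lt_succ) p.continuous.continuousOn
      (by simp only [hp _ (hf _)])
    exact ⟨c, hc, by simpa using h0⟩
  choose g hg h0 using key
  have hmono : StrictMono g := by
    intro i j hij
    calc g i < f i.succ := (hg i).2
      _ ≤ f j.castSucc := f.monotone (by simpa [Fin.le_def] using hij)
      _ < g j := (hg j).1
  refine ⟨Finset.univ.map ⟨g, hmono.injective⟩, by simp, ?_⟩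
  intro t ht
  obtain ⟨i, -, rfl⟩ := Finset.mem_map.1 ht
  exact ⟨⟨(hI _ (hf _)).1.trans_lt (hg i).1, (hg i).2.trans_le (hI _ (hf _)).2⟩, h0 i⟩

-- `a` is a zero of multiplicity at least `r`, and each derivative costs one.
open Polynomial in
theorem eval_iterate_derivative_eq_zero {r m : ℕ} (hm : m < r) {a : ℝ} (ha : a ^ 2 = 1) :
    (derivative^[m] ((X ^ 2 - 1 : ℝ[X]) ^ r)).eval a = 0 := by
  have h1 : (X - C a) ^ r ∣ (X ^ 2 - 1 : ℝ[X]) ^ r := by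
    apply pow_dvd_pow_of_dvd
    rw [dvd_iff_isRoot]
    simp [ha]
  have h2 := pow_sub_dvd_iterate_derivative_of_pow_dvd m h1
  have h3 : (X - C a) ∣ derivative^[m] ((X ^ 2 - 1 : ℝ[X]) ^ r) :=
    (dvd_pow_self _ (by lia)).trans h2
  exact dvd_iff_isRoot.1 h3

-- Induction on `m`: for `m < r` the end points are still zeros, so `m` interior zeros give `m + 2`
-- zeros in all, and Rolle yields `m + 1`.
open Polynomial in
theorem exists_finset_iterate_derivative_roots {r : ℕ} :
    ∀ m ≤ r, ∃ S : Finset ℝ, S.card = m ∧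
      ∀ t ∈ S, t ∈ Set.Ioo (-1 : ℝ) 1 ∧ (derivative^[m] ((X ^ 2 - 1 : ℝ[X]) ^ r)).eval t = 0
  | 0, _ => ⟨∅, by simp⟩
  | m + 1, hm => by
    obtain ⟨S, hS, h⟩ := exists_finset_iterate_derivative_roots (r := r) m (by lia)
    have h1 : (1 : ℝ) ∉ S := fun h' => (h _ h').1.2.ne rfl
    have h2 : (-1 : ℝ) ∉ insert 1 S := by
      rw [Finset.mem_insert, not_or]
      exact ⟨by norm_num, fun h' => (h _ h').1.1.ne rfl⟩
    rw [Function.iterate_succ_apply']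
    apply exists_finset_derivative_roots (T := insert (-1) (insert 1 S))
    · rw [Finset.card_insert_of_notMem h2, Finset.card_insert_of_notMem h1, hS]
    · intro t ht
      simp only [Finset.mem_insert] at ht
      rcases ht with rfl | rfl | ht
      · norm_num
      · norm_num
      · exact ⟨(h _ ht).1.1.le, (h _ ht).1.2.le⟩
    · intro t ht
      simp only [Finset.mem_insert] at ht
      rcases ht with rfl | rfl | ht
      · exact eval_iterate_derivative_eq_zero (by lia) (by norm_num)
      · exact eval_iterate_derivative_eq_zero (by lia) (by norm_num)
      · exact (h _ ht).2

open Polynomial in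
theorem eval_derivative_legendre_eq_zero_iff {r : ℕ} {t : ℝ} :
    (legendre r).derivative.eval t = 0 ↔
      (derivative^[r + 1] ((X ^ 2 - 1 : ℝ[X]) ^ r)).eval t = 0 := by
  rw [Function.iterate_succ_apply', legendre, derivative_C_mul, eval_C_mul, mul_eq_zero]
  have : (1 / (2 ^ r * (r.factorial : ℝ))) ≠ 0 := by positivity
  simp only [this, false_or]

open Polynomial in
/-- The interior Gauss–Lobatto nodes as a finite set. -/
theorem exists_finset_interior_nodes {r : ℕ} (hr : 1 ≤ r) :
    ∃ S : Finset ℝ, S.card = r - 1 ∧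
      (S : Set ℝ) = {t | t ∈ Set.Ioo (-1 : ℝ) 1 ∧ (legendre r).derivative.eval t = 0} := by
  obtain ⟨T, hT, h⟩ := exists_finset_iterate_derivative_roots (r := r) r le_rfl
  -- The end points are no longer available for the `r`-th derivative, so this last Rolle step loses
  -- a zero.
  obtain ⟨S, hS, hS'⟩ := exists_finset_derivative_roots (m := r - 1) (T := T) (by lia)
    (fun t ht => ⟨(h t ht).1.1.le, (h t ht).1.2.le⟩) (fun t ht => (h t ht).2)
  rw [← Function.iterate_succ_apply' (f := derivative)] at hS'
  set q := derivative^[r + 1] ((X ^ 2 - 1 : ℝ[X]) ^ r) with hq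
  have hdeg : ((X ^ 2 - 1 : ℝ[X]) ^ r).natDegree = 2 * r := by
    have : (X ^ 2 - 1 : ℝ[X]).natDegree = 2 := by compute_degree!
    rw [natDegree_pow, this, mul_comm]
  have hq0 : q ≠ 0 := by
    intro h0
    -- This coefficient is a nonzero multiple of the leading one, as `(r - 1) + (r + 1) = 2 * r`.
    have hc := congrArg (fun p => p.coeff (r - 1)) h0
    simp only [hq, coeff_iterate_derivative, coeff_zero] at hc
    have e : r - 1 + (r + 1) = ((X ^ 2 - 1 : ℝ[X]) ^ r).natDegree := by rw [hdeg]; lia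
    rw [e, coeff_natDegree, smul_eq_zero] at hc
    rcases hc with hc | hc
    · rw [Nat.descFactorial_eq_zero_iff_lt] at hc
      lia
    · rw [leadingCoeff_eq_zero] at hc
      rw [hc, natDegree_zero] at hdeg
      lia
  have hqd : q.natDegree ≤ r - 1 := by
    have := natDegree_iterate_derivative ((X ^ 2 - 1 : ℝ[X]) ^ r) (r + 1)
    rw [hdeg] at this
    lia
  have hsub : S ⊆ q.roots.toFinset := by
    intro t ht
    rw [Multiset.mem_toFinset, mem_roots hq0]
    exact (hS' t ht).2
  -- The degree bound `r - 1` leaves no room for zeros beyond those found by Rolle.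
  have heq : S = q.roots.toFinset := Finset.eq_of_subset_of_card_le hsub (by
    rw [hS]
    exact (Multiset.toFinset_card_le _).trans ((card_roots' q).trans hqd))
  refine ⟨S, hS, ?_⟩
  ext t
  simp only [Finset.mem_coe, Set.mem_ofPred_eq, eval_derivative_legendre_eq_zero_iff]
  refine ⟨fun ht => hS' t ht, fun ht => ?_⟩
  rw [heq, Multiset.mem_toFinset, mem_roots hq0]
  exact ht.2

theorem exists_finset_gaussLobattoNodes {r : ℕ} (hr : 1 ≤ r) :
    ∃ S : Finset ℝ, S.card = r + 1 ∧ (S : Set ℝ) = gaussLobattoNodes r := by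
  obtain ⟨S, hS, h⟩ := exists_finset_interior_nodes hr
  have h' : ∀ t ∈ S, t ∈ Set.Ioo (-1 : ℝ) 1 := fun t ht => by
    have : t ∈ (S : Set ℝ) := ht
    rw [h] at this
    exact this.1
  have h1 : (1 : ℝ) ∉ S := fun hh => (h' _ hh).2.ne rfl
  have h2 : (-1 : ℝ) ∉ insert 1 S := by
    rw [Finset.mem_insert, not_or]
    exact ⟨by norm_num, fun hh => (h' _ hh).1.ne rfl⟩
  refine ⟨insert (-1) (insert 1 S), ?_, ?_⟩
  · rw [Finset.card_insert_of_notMem h2, Finset.card_insert_of_notMem h1, hS]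
    lia
  · rw [gaussLobattoNodes, ← h]
    ext t
    simp [or_assoc]

theorem gaussLobattoNodes_subset_Icc (r : ℕ) : gaussLobattoNodes r ⊆ Set.Icc (-1 : ℝ) 1 := by
  rintro t ((rfl | rfl) | ⟨ht, -⟩)
  · norm_num
  · norm_num
  · exact ⟨ht.1.le, ht.2.le⟩

/-- Grid points are exactly the tuples of Gauss–Lobatto nodes. -/
def gridEquiv (n r : ℕ) : grid n r ≃ (Fin n → gaussLobattoNodes r) where
  toFun x i := ⟨x.1.1 i, x.2 i⟩
  invFun y := ⟨⟨fun i => (y i).1, fun i => gaussLobattoNodes_subset_Icc r (y i).2⟩,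
    fun i => (y i).2⟩
  left_inv _ := rfl
  right_inv _ := rfl

theorem natCard_gaussLobattoNodes {r : ℕ} (hr : 1 ≤ r) :
    Nat.card (gaussLobattoNodes r) = r + 1 := by
  obtain ⟨S, hS, h⟩ := exists_finset_gaussLobattoNodes hr
  rw [← h, Nat.card_coe_set_eq, Set.ncard_coe_finset, hS]

theorem natCard_grid {n r : ℕ} (hr : 1 ≤ r) : Nat.card (grid n r) = (r + 1) ^ n := by
  rw [Nat.card_congr (gridEquiv n r), Nat.card_pi]
  simp [natCard_gaussLobattoNodes hr]

theorem finite_grid {n r : ℕ} (hr : 1 ≤ r) : Finite (grid n r) :=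
  Nat.finite_of_card_ne_zero (by rw [natCard_grid hr]; positivity)

/-! ### The Fischer inner product -/

open MvPolynomial in
/-- The Fischer inner product of polynomials, `⟨x^β, x^γ⟩ = β! δ_{βγ}`. -/
def fischer (n : ℕ) : MvPolynomial (Fin n) ℝ →ₗ[ℝ] MvPolynomial (Fin n) ℝ →ₗ[ℝ] ℝ :=
  (basisMonomials (Fin n) ℝ).constr ℝ fun β => (∏ i, ((β i).factorial : ℝ)) • lcoeff ℝ β

open MvPolynomial in
theorem fischer_monomial {n : ℕ} (β : Fin n →₀ ℕ) (G : MvPolynomial (Fin n) ℝ) :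
    fischer n (monomial β 1) G = (∏ i, ((β i).factorial : ℝ)) * coeff β G := by
  have h := (basisMonomials (Fin n) ℝ).constr_basis ℝ
    (fun β => (∏ i, ((β i).factorial : ℝ)) • lcoeff ℝ β) β
  rw [coe_basisMonomials] at h
  rw [fischer, h]
  rfl

open MvPolynomial in
theorem fischer_apply {n : ℕ} (F G : MvPolynomial (Fin n) ℝ) :
    fischer n F G =
      ∑ β ∈ F.support, coeff β F * ((∏ i, ((β i).factorial : ℝ)) * coeff β G) := by
  conv_lhs => rw [F.as_sum]
  rw [map_sum, LinearMap.sum_apply]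
  refine Finset.sum_congr rfl fun β _ => ?_
  rw [← fischer_monomial, ← smul_eq_mul, ← LinearMap.smul_apply, ← map_smul, smul_monomial,
    smul_eq_mul, mul_one]

open MvPolynomial in
/-- Multiplication by `x_i` is adjoint to `∂_i`. -/
theorem fischer_X_mul {n : ℕ} (i : Fin n) (F G : MvPolynomial (Fin n) ℝ) :
    fischer n (X i * F) G = fischer n F (pderiv i G) := by
  have h : (fischer n).flip G ∘ₗ LinearMap.mulLeft ℝ (X i) =
      (fischer n).flip (pderiv i G) := by
    refine (basisMonomials (Fin n) ℝ).ext fun β => ?_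
    simp only [coe_basisMonomials, LinearMap.comp_apply, LinearMap.mulLeft_apply,
      LinearMap.flip_apply]
    rw [X, monomial_mul, one_mul, fischer_monomial, fischer_monomial, coeff_pderiv,
      add_comm (Finsupp.single i 1) β]
    have hp : (∏ j, (((β + Finsupp.single i 1 : Fin n →₀ ℕ) j).factorial : ℝ)) =
        (β i + 1) * ∏ j, ((β j).factorial : ℝ) := by
      rw [← Finset.mul_prod_erase _ _ (Finset.mem_univ i),
        ← Finset.mul_prod_erase _ (fun j => ((β j).factorial : ℝ)) (Finset.mem_univ i),
        ← mul_assoc]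
      congr 1
      · simp [Nat.factorial_succ]
      · refine Finset.prod_congr rfl fun j hj => ?_
        have : j ≠ i := Finset.ne_of_mem_erase hj
        simp [this.symm]
    rw [hp]
    ring
  exact LinearMap.congr_fun h F

open MvPolynomial in
theorem fischer_self_nonneg {n : ℕ} (F : MvPolynomial (Fin n) ℝ) : 0 ≤ fischer n F F := by
  rw [fischer_apply]
  refine Finset.sum_nonneg fun β _ => ?_
  have : 0 ≤ (∏ i, ((β i).factorial : ℝ)) := by positivity
  nlinarith [mul_nonneg this (mul_self_nonneg (coeff β F))]

open MvPolynomial in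
theorem eq_zero_of_fischer_self {n : ℕ} {F : MvPolynomial (Fin n) ℝ} (h : fischer n F F = 0) :
    F = 0 := by
  by_contra hF
  obtain ⟨β, hβ⟩ := Finset.nonempty_iff_ne_empty.2 (mt support_eq_empty.1 hF)
  have : 0 < fischer n F F := by
    rw [fischer_apply]
    have hpos : ∀ γ ∈ F.support,
        0 < coeff γ F * ((∏ i, ((γ i).factorial : ℝ)) * coeff γ F) := by
      intro γ hγ
      have h1 : 0 < (∏ i, ((γ i).factorial : ℝ)) :=
        Finset.prod_pos fun i _ => by positivity
      have h2 : 0 < coeff γ F * coeff γ F := mul_self_pos.2 (mem_support_iff.1 hγ)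
      nlinarith [mul_pos h1 h2]
    exact Finset.sum_pos hpos ⟨β, hβ⟩
  exact (ne_of_gt this) h

/-! ### `d` and `κ` on coefficient families -/

/-- Families of polynomials indexed by `k`-tuples of coordinate directions: the coefficients of a
polynomial `k`-form on all tuples of basis vectors. -/
abbrev Fam (n k : ℕ) : Type := (Fin k → Fin n) → MvPolynomial (Fin n) ℝ

/-- The tuple of basis vectors `(e_{f 1}, …, e_{f k})`. -/
def basisTuple {n k : ℕ} (f : Fin k → Fin n) : Fin k → Fin n → ℝ := fun i => Pi.single (f i) 1

theorem basisTuple_vecCons {n k : ℕ} (j : Fin n) (g : Fin k → Fin n) :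
    basisTuple (Matrix.vecCons j g) = Matrix.vecCons (Pi.single j 1) (basisTuple g) := by
  funext i
  refine Fin.cases ?_ (fun i => ?_) i <;> rfl

theorem removeNth_basisTuple {n k : ℕ} (i : Fin (k + 1)) (f : Fin (k + 1) → Fin n) :
    i.removeNth (basisTuple f) = basisTuple (i.removeNth f) := rfl

/-- The exterior derivative on coefficient families. -/
def famD (n k : ℕ) : Fam n k →ₗ[ℝ] Fam n (k + 1) where
  toFun U f := ∑ i : Fin (k + 1), (-1 : ℝ) ^ (i : ℕ) •
    MvPolynomial.pderiv (f i) (U (i.removeNth f))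
  map_add' U V := by
    funext f
    simp [Finset.sum_add_distrib]
  map_smul' a U := by
    funext f
    simp only [Pi.smul_apply, Derivation.map_smul, RingHom.id_apply, Finset.smul_sum]
    exact Finset.sum_congr rfl fun i _ => smul_comm _ _ _

/-- The Koszul operator on coefficient families. -/
def famK (n k : ℕ) : Fam n (k + 1) →ₗ[ℝ] Fam n k where
  toFun U g := ∑ j, MvPolynomial.X j * U (Matrix.vecCons j g)
  map_add' U V := by
    funext g
    simp [mul_add, Finset.sum_add_distrib]
  map_smul' a U := by
    funext g
    simp [Finset.smul_sum]

/-- `d κ` on coefficient families, zero in degree zero. -/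
def famDK (n : ℕ) : (k : ℕ) → Fam n k →ₗ[ℝ] Fam n k
  | 0 => 0
  | k + 1 => famD n k ∘ₗ famK n k

/-- A family is alternating if it comes from an alternating map. -/
def IsAlt {n k : ℕ} (U : Fam n k) : Prop :=
  ∃ A : (Fin n → ℝ) [⋀^Fin k]→ₗ[ℝ] MvPolynomial (Fin n) ℝ, ∀ f, U f = A (basisTuple f)

/-- Moving the `i`-th direction to the front costs the sign `(-1)^i`, the very sign occurring in the
exterior derivative. -/
theorem IsAlt.apply_eq {n k : ℕ} {U : Fam n (k + 1)} (h : IsAlt U) (i : Fin (k + 1))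
    (f : Fin (k + 1) → Fin n) :
    (-1 : ℝ) ^ (i : ℕ) • U f = U (Matrix.vecCons (f i) (i.removeNth f)) := by
  obtain ⟨A, hA⟩ := h
  rw [hA, hA, basisTuple_vecCons]
  have h1 := A.neg_one_pow_smul_map_insertNth i (Pi.single (f i) 1)
    (basisTuple (i.removeNth f))
  have h2 : i.insertNth (Pi.single (f i) 1) (basisTuple (i.removeNth f)) = basisTuple f := by
    rw [← removeNth_basisTuple]
    exact i.insertNth_self_removeNth (basisTuple f)
  rw [h2] at h1
  rw [← h1]
  rcases Nat.even_or_odd (i : ℕ) with h | h <;> simp [h.neg_one_pow]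

/-- The Koszul operator is, up to a factor, adjoint to `d` for the Fischer inner product. -/
theorem sum_fischer_famD {n k : ℕ} {U : Fam n (k + 1)} (hU : IsAlt U) (W : Fam n k) :
    ∑ f, fischer n (U f) (famD n k W f) =
      (k + 1) * ∑ g, fischer n (famK n k U g) (W g) := by
  have h1 : ∀ f, fischer n (U f) (famD n k W f) = ∑ i : Fin (k + 1),
      fischer n (MvPolynomial.X (f i) * U (Matrix.vecCons (f i) (i.removeNth f)))
        (W (i.removeNth f)) := by
    intro f
    simp only [famD, LinearMap.coe_mk, AddHom.coe_mk, map_sum]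
    refine Finset.sum_congr rfl fun i _ => ?_
    rw [fischer_X_mul, ← hU.apply_eq, map_smul, map_smul, LinearMap.smul_apply]
  have h2 : ∀ i : Fin (k + 1), ∑ f : Fin (k + 1) → Fin n,
      fischer n (MvPolynomial.X (f i) * U (Matrix.vecCons (f i) (i.removeNth f)))
        (W (i.removeNth f)) = ∑ g, fischer n (famK n k U g) (W g) := by
    intro i
    -- Split `f` into its `i`-th entry `j` and the rest `g`; summing over `j` rebuilds `κ`. The
    -- result does not depend on `i`, which is the source of the factor `k + 1`.
    rw [← (Fin.insertNthEquiv (fun _ => Fin n) i).sum_comp, Fintype.sum_prod_type_right]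
    refine Finset.sum_congr rfl fun g _ => ?_
    have hg : ∀ j : Fin n, i.removeNth (Fin.insertNthEquiv (fun _ => Fin n) i (j, g)) = g :=
      fun j => Fin.removeNth_insertNth (α := fun _ => Fin n) i j g
    simp only [famK, LinearMap.coe_mk, AddHom.coe_mk, map_sum, LinearMap.sum_apply, hg,
      Fin.insertNthEquiv_apply, Fin.insertNth_apply_same]
  simp_rw [h1]
  rw [Finset.sum_comm]
  simp_rw [h2]
  simp

open MvPolynomial in
/-- The Koszul operator is injective on alternating families all of whose monomials have partial
degrees at most `r`, attained in one of the directions of the form part. -/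
theorem eq_zero_of_famK_eq_zero {n k r : ℕ} {P : Fam n (k + 1)} (hA : IsAlt P)
    (hP : ∀ f β, coeff β (P f) ≠ 0 → (∀ i, β i ≤ r) ∧ ∃ i, β (f i) = r)
    (h : famK n k P = 0) : P = 0 := by
  funext f
  ext β
  by_contra hne
  obtain ⟨hβ, i, hi⟩ := hP f β hne
  -- At this exponent only `j = f i` contributes to `κ`: for other `j`, the coefficient of `P` would
  -- sit at partial degree `r + 1` in direction `f i`.
  have h0 := congrArg (coeff (β + Finsupp.single (f i) 1)) (congrFun h (i.removeNth f))
  simp only [famK, LinearMap.coe_mk, AddHom.coe_mk, Pi.zero_apply, coeff_zero, coeff_sum] at h0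
  rw [Finset.sum_eq_single (f i), add_comm, coeff_X_mul, ← hA.apply_eq, coeff_smul,
    smul_eq_zero] at h0
  · exact h0.elim (fun h => by simp at h) hne
  · intro j _ hj
    rw [coeff_X_mul']
    split_ifs
    · by_contra hne'
      have := (hP _ _ hne').1 (f i)
      simp [hj, hi] at this
    · rfl
  · simp

-- On the monomials of `P` the family `Q` vanishes, hence so does `dκP`. Thus `0 = ⟨P, dκP⟩ = (k +
-- 1) ‖κP‖²` in the Fischer norm, and injectivity of `κ` applies.
open MvPolynomial in
theorem eq_zero_of_coeff_add_famDK_eq_zero {n k r : ℕ} {P Q : Fam n k} (hA : IsAlt P)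
    (hP : ∀ f β, coeff β (P f) ≠ 0 → (∀ i, β i ≤ r) ∧ ∃ i, β (f i) = r)
    (hQ : ∀ f β, coeff β (Q f) ≠ 0 → (∀ i, β i ≤ r) ∧ ∀ i, β (f i) ≠ r)
    (hW : ∀ f β, (∀ i, β i ≤ r) → coeff β (Q f + famDK n k P f) = 0) : P = 0 ∧ Q = 0 := by
  have hP0 : P = 0 := by
    cases k with
    | zero =>
      funext f
      ext β
      by_contra hne
      obtain ⟨-, i, -⟩ := hP f β hne
      exact i.elim0
    | succ k =>
      refine eq_zero_of_famK_eq_zero hA hP ?_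
      have h1 : ∀ f, fischer n (P f) (famDK n (k + 1) P f) = 0 := by
        intro f
        rw [fischer_apply]
        refine Finset.sum_eq_zero fun β hβ => ?_
        obtain ⟨hr, i, hi⟩ := hP f β (mem_support_iff.1 hβ)
        have hq : coeff β (Q f) = 0 := by
          by_contra hne
          exact (hQ f β hne).2 i hi
        have hw := hW f β hr
        rw [coeff_add, hq, zero_add] at hw
        rw [hw, mul_zero, mul_zero]
      have h2 : ∑ f, fischer n (P f) (famDK n (k + 1) P f) = _ :=
        sum_fischer_famD hA (famK n k P)
      rw [Finset.sum_eq_zero fun f _ => h1 f, eq_comm, mul_eq_zero] at h2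
      have h3 := h2.resolve_left (by positivity)
      rw [Finset.sum_eq_zero_iff_of_nonneg fun g _ => fischer_self_nonneg _] at h3
      funext g
      exact eq_zero_of_fischer_self (h3 g (Finset.mem_univ g))
  refine ⟨hP0, ?_⟩
  funext f
  ext β
  by_contra hne
  have := hW f β (hQ f β hne).1
  rw [hP0, map_zero, Pi.zero_apply, add_zero] at this
  exact hne this

/-! ### From differential forms to coefficient families -/

/-- The family `U` lists the coefficients of the form `u` on all tuples of basis vectors. -/
def Represents {n k : ℕ} (u : Form n k) (U : Fam n k) : Prop :=
  ∀ x f, u x (basisTuple f) = MvPolynomial.eval x (U f)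

theorem Represents.koszul {n k : ℕ} {u : Form n (k + 1)} {U : Fam n (k + 1)}
    (h : Represents u U) : Represents (koszul u) (famK n k U) := by
  intro x g
  have hx : (u x).curryLeft x = ∑ j, x j • (u x).curryLeft (Pi.single j 1) := by
    generalize u x = A
    conv_lhs => rw [pi_eq_sum_univ' x, map_sum]
    exact Finset.sum_congr rfl fun j _ => map_smul _ _ _
  rw [CubicalForms.koszul, hx]
  simp only [ContinuousAlternatingMap.sum_apply, ContinuousAlternatingMap.smul_apply,
    ContinuousAlternatingMap.curryLeft_apply_apply, ← basisTuple_vecCons, h x, famK,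
    LinearMap.coe_mk, AddHom.coe_mk, map_sum, map_mul, MvPolynomial.eval_X, smul_eq_mul]

open MvPolynomial in
theorem hasFDerivAt_eval {n : ℕ} (p : MvPolynomial (Fin n) ℝ) (x : Fin n → ℝ) :
    HasFDerivAt (fun y => eval y p)
      (∑ i, eval x (pderiv i p) • ContinuousLinearMap.proj (R := ℝ) (φ := fun _ : Fin n => ℝ) i)
      x := by
  induction p using MvPolynomial.induction_on with
  | C a => simpa using hasFDerivAt_const a x
  | add p q hp hq =>
    simp only [map_add, add_smul, Finset.sum_add_distrib]
    exact hp.add hq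
  | mul_X p j hp =>
    have hX : HasFDerivAt (fun y : Fin n → ℝ => y j)
        (ContinuousLinearMap.proj (R := ℝ) (φ := fun _ : Fin n => ℝ) j) x :=
      hasFDerivAt_apply j x
    have := hp.mul hX
    simp only [map_mul, eval_X]
    refine this.congr_fderiv ?_
    ext v
    simp [pderiv_X, Pi.single_apply, add_mul, Finset.sum_add_distrib, Finset.mul_sum,
      apply_ite]
    exact Finset.sum_congr rfl fun i _ => (mul_assoc _ _ _).symm

theorem Represents.extDeriv {n k : ℕ} {w : Form n k} {W : Fam n k}
    (h : Represents w W) (hw : Differentiable ℝ w) : Represents (extDeriv w) (famD n k W) := by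
  intro x f
  rw [extDeriv_apply (hw x)]
  simp only [famD, LinearMap.coe_mk, AddHom.coe_mk, map_sum, removeNth_basisTuple, h _ _,
    (hasFDerivAt_eval _ _).fderiv, MvPolynomial.smul_eval]
  refine Finset.sum_congr rfl fun i _ => ?_
  have : basisTuple f i = Pi.single (f i) 1 := rfl
  rw [this]
  rcases Nat.even_or_odd (i : ℕ) with hi | hi <;>
    simp [hi.neg_one_pow, Pi.single_apply]

theorem koszul_formMonomial {n k : ℕ} (α : Fin n → ℕ) (σ : Idx n (k + 1)) :
    koszul (formMonomial α σ) = fun x => (∏ i, x i ^ α i) • (dx σ).curryLeft x := by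
  funext x
  ext v
  rfl

theorem differentiable_koszul_formMonomial {n k : ℕ} (α : Fin n → ℕ) (σ : Idx n (k + 1)) :
    Differentiable ℝ (koszul (formMonomial α σ)) := by
  rw [koszul_formMonomial]
  fun_prop

/-- `d κ` on forms, zero in degree zero. -/
def dKoszul {n : ℕ} : {k : ℕ} → Form n k → Form n k
  | 0, _ => 0
  | _ + 1, u => extDeriv (koszul u)

/-- The coefficient family of `x^α dx_σ`. -/
def famMonomial {n k : ℕ} (α : Fin n → ℕ) (σ : Idx n k) : Fam n k :=
  fun f => MvPolynomial.monomial (Finsupp.equivFunOnFinite.symm α) (dx σ (basisTuple f))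

theorem represents_formMonomial {n k : ℕ} (α : Fin n → ℕ) (σ : Idx n k) :
    Represents (formMonomial α σ) (famMonomial α σ) := by
  intro x f
  rw [famMonomial, MvPolynomial.eval_monomial, Finsupp.prod_fintype _ _ (by simp), mul_comm]
  rfl

theorem represents_dKoszul_formMonomial {n k : ℕ} (α : Fin n → ℕ) (σ : Idx n k) :
    Represents (dKoszul (formMonomial α σ)) (famDK n k (famMonomial α σ)) := by
  cases k with
  | zero =>
    intro x f
    simp [dKoszul, famDK]
  | succ k =>
    exact (represents_formMonomial α σ).koszul.extDeriv (differentiable_koszul_formMonomial α σ)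

open MvPolynomial in
theorem isHomogeneous_famMonomial {n k : ℕ} (α : Fin n → ℕ) (σ : Idx n k) (f : Fin k → Fin n) :
    (famMonomial α σ f).IsHomogeneous (∑ i, α i) :=
  isHomogeneous_monomial _ (by rw [Finsupp.degree_eq_sum]; rfl)

-- `κ` raises the degree by one and `d` lowers it by one; this allows isolating the top-degree part.
open MvPolynomial in
theorem isHomogeneous_famDK {n k d : ℕ} {U : Fam n k} (hU : ∀ f, (U f).IsHomogeneous d)
    (f : Fin k → Fin n) : (famDK n k U f).IsHomogeneous d := by
  cases k with
  | zero => exact isHomogeneous_zero _ _ _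
  | succ k =>
    have hK : ∀ g, (famK n k U g).IsHomogeneous (1 + d) := fun g =>
      IsHomogeneous.sum _ _ _ fun j _ => (isHomogeneous_X ℝ j).mul (hU _)
    refine IsHomogeneous.sum _ _ _ fun i _ => ?_
    have := (hK (i.removeNth f)).pderiv (i := f i)
    rw [Nat.add_sub_cancel_left] at this
    exact (homogeneousSubmodule (Fin n) ℝ d).smul_mem _ this

/-! ### Alternating maps on tuples of basis vectors -/

/-- `dx_σ` only sees tuples of basis vectors with the same directions as `σ`. -/
theorem range_eq_of_dx_basisTuple_ne_zero {n k : ℕ} {σ : Idx n k} {f : Fin k → Fin n}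
    (h : dx σ (basisTuple f) ≠ 0) : Set.range f = Set.range σ := by
  rw [dx_apply] at h
  apply Set.Subset.antisymm
  · rintro _ ⟨i, rfl⟩
    by_contra hi
    refine h (Matrix.det_eq_zero_of_row_eq_zero i fun j => ?_)
    have : σ j ≠ f i := fun hj => hi ⟨j, hj⟩
    simp [basisTuple, this]
  · rintro _ ⟨j, rfl⟩
    by_contra hj
    refine h (Matrix.det_eq_zero_of_column_eq_zero j fun i => ?_)
    have : σ j ≠ f i := fun hi => hj ⟨i, hi.symm⟩
    simp [basisTuple, this]

theorem dx_basisTuple_self {n k : ℕ} (σ : Idx n k) : dx σ (basisTuple σ) = 1 := by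
  rw [dx_apply]
  convert Matrix.det_one (n := Fin k) (R := ℝ)
  ext i j
  simp [basisTuple, Pi.single_apply, Matrix.one_apply, eq_comm]

theorem dx_basisTuple_of_ne {n k : ℕ} {σ τ : Idx n k} (h : σ ≠ τ) :
    dx σ (basisTuple τ) = 0 := by
  by_contra hne
  have hr := range_eq_of_dx_basisTuple_ne_zero hne
  exact h (DFunLike.coe_injective ((StrictMono.range_inj σ.strictMono τ.strictMono).1 hr.symm))

/-- An alternating map that vanishes on increasing tuples of basis vectors vanishes on all
tuples of basis vectors. -/
theorem apply_basisTuple_eq_zero {n k : ℕ} {A : Alt n k} (h : ∀ σ : Idx n k, A (basisTuple σ) = 0)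
    (f : Fin k → Fin n) : A (basisTuple f) = 0 := by
  by_cases hf : Function.Injective f
  · have hm : StrictMono (f ∘ Tuple.sort f) :=
      (Tuple.monotone_sort f).strictMono_of_injective (hf.comp (Tuple.sort f).injective)
    have h1 := h (OrderEmbedding.ofStrictMono _ hm)
    have h2 : basisTuple (OrderEmbedding.ofStrictMono _ hm) = basisTuple f ∘ Tuple.sort f := rfl
    rw [h2] at h1
    have h3 := A.toAlternatingMap.map_perm (basisTuple f) (Tuple.sort f)
    have h4 : A (basisTuple f ∘ Tuple.sort f) =
      Equiv.Perm.sign (Tuple.sort f) • A (basisTuple f) := h3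
    rw [h1, eq_comm, smul_eq_zero_iff_eq] at h4
    exact h4
  · simp only [Function.Injective, not_forall] at hf
    obtain ⟨i, j, hij, hne⟩ := hf
    exact A.map_eq_zero_of_eq _ (by simp [basisTuple, hij]) hne

/-! ### The spanning shape functions -/

/-- Indices of the monomials `x^α dx_σ` with `α i ≤ r`. -/
abbrev ShapeIdx (n r k : ℕ) : Type := Idx n k × (Fin n → Fin (r + 1))

/-- The multi-index of a shape index, with natural number entries. -/
def ShapeIdx.exponent {n r k : ℕ} (p : ShapeIdx n r k) : Fin n → ℕ := fun i => p.2 i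

/-- The monomials of `𝒬_r⁻ Λ^k`, and `d κ` of the monomials of `ℬ_r Λ^k`. -/
def shapeForm {n r k : ℕ} (p : ShapeIdx n r k) : Form n k :=
  if cdeg r p.exponent p.1 = 0 then formMonomial p.exponent p.1
  else dKoszul (formMonomial p.exponent p.1)

/-- The coefficient family of `shapeForm p`. -/
def shapeFam {n r k : ℕ} (p : ShapeIdx n r k) : Fam n k :=
  if cdeg r p.exponent p.1 = 0 then famMonomial p.exponent p.1
  else famDK n k (famMonomial p.exponent p.1)

theorem represents_shapeForm {n r k : ℕ} (p : ShapeIdx n r k) :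
    Represents (shapeForm p) (shapeFam p) := by
  unfold shapeForm shapeFam
  split_ifs
  · exact represents_formMonomial _ _
  · exact represents_dKoszul_formMonomial _ _

theorem isHomogeneous_shapeFam {n r k : ℕ} (p : ShapeIdx n r k) (f : Fin k → Fin n) :
    (shapeFam p f).IsHomogeneous (∑ i, p.exponent i) := by
  unfold shapeFam
  split_ifs
  · exact isHomogeneous_famMonomial _ _ _
  · exact isHomogeneous_famDK (isHomogeneous_famMonomial _ _) _

theorem cdeg_eq_zero_iff {n k s : ℕ} {α : Fin n → ℕ} {σ : Idx n k} :
    cdeg s α σ = 0 ↔ ∀ j, α (σ j) ≠ s := by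
  simp [cdeg, Finset.filter_eq_empty_iff]

theorem QTilde_eq_span (n r k : ℕ) :
    QTilde n r k = Submodule.span ℝ (Set.range (shapeForm (n := n) (r := r) (k := k))) := by
  have lift : ∀ (α : Fin n → ℕ) (σ : Idx n k), (∀ i, α i ≤ r) →
      ∃ p : ShapeIdx n r k, p.exponent = α ∧ p.1 = σ := fun α σ hα =>
    ⟨(σ, fun i => ⟨α i, Nat.lt_succ_of_le (hα i)⟩), rfl, rfl⟩
  apply le_antisymm
  · refine sup_le (Submodule.span_le.2 ?_) ?_
    · rintro _ ⟨α, σ, hα, hc, rfl⟩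
      obtain ⟨p, rfl, rfl⟩ := lift α σ hα
      exact Submodule.subset_span ⟨p, by simp [shapeForm, hc]⟩
    · cases k with
      | zero => exact bot_le
      | succ k =>
        refine Submodule.span_le.2 ?_
        rintro _ ⟨u, hu, rfl⟩
        -- `d` is additive only on differentiable forms, so differentiability is carried through the
        -- span induction.
        suffices h : Differentiable ℝ (koszul u) ∧ extDeriv (koszul u) ∈
            Submodule.span ℝ (Set.range (shapeForm (n := n) (r := r) (k := k + 1))) from h.2
        rw [SetLike.mem_coe, B] at hu
        induction hu using Submodule.span_induction with
        | mem u h =>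
          obtain ⟨α, σ, hα, hc, rfl⟩ := h
          obtain ⟨p, rfl, rfl⟩ := lift α σ hα
          exact ⟨differentiable_koszul_formMonomial _ _,
            Submodule.subset_span ⟨p, by rw [shapeForm, if_neg hc.ne']; rfl⟩⟩
        | zero =>
          have h0 : koszul (0 : Form n (k + 1)) = 0 := by
            funext x
            ext v
            simp [koszul]
          have h1 : extDeriv (0 : Form n k) = 0 := by
            funext x
            simpa using extDeriv_smul (x := x) (0 : ℝ) (0 : Form n k)
          rw [h0, h1]
          exact ⟨differentiable_const _, Submodule.zero_mem _⟩
        | add u v hu hv ihu ihv =>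
          obtain ⟨du, mu⟩ := ihu
          obtain ⟨dv, mv⟩ := ihv
          have h0 : koszul (u + v) = koszul u + koszul v := by
            funext x
            ext t
            simp [koszul]
          have h1 : extDeriv (koszul u + koszul v) =
              extDeriv (koszul u) + extDeriv (koszul v) := by
            funext x
            exact extDeriv_add (du x) (dv x)
          rw [h0, h1]
          exact ⟨du.add dv, Submodule.add_mem _ mu mv⟩
        | smul a u hu ihu =>
          obtain ⟨du, mu⟩ := ihu
          have h0 : koszul (a • u) = a • koszul u := by
            funext x
            ext t
            simp [koszul]
          have h1 : extDeriv (a • koszul u) = a • extDeriv (koszul u) := by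
            funext x
            exact extDeriv_smul a _
          rw [h0, h1]
          exact ⟨du.const_smul a, Submodule.smul_mem _ _ mu⟩
  · refine Submodule.span_le.2 ?_
    rintro _ ⟨p, rfl⟩
    have hp : ∀ i, p.exponent i ≤ r := fun i => Nat.lt_succ_iff.1 (p.2 i).2
    unfold shapeForm
    split_ifs with hc
    · exact Submodule.mem_sup_left (Submodule.subset_span ⟨_, _, hp, hc, rfl⟩)
    · refine Submodule.mem_sup_right ?_
      cases k with
      | zero => exact Submodule.zero_mem _
      | succ k =>
        exact Submodule.subset_span
          ⟨_, Submodule.subset_span ⟨_, _, hp, Nat.pos_of_ne_zero hc, rfl⟩, rfl⟩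

/-! ### The `ℬ_r` and `𝒬_r⁻` parts of a combination -/

/-- The part of `∑ c_p x^α dx_σ` in `ℬ_r Λ^k`, as a coefficient family. -/
def famB {n r k : ℕ} (c : ShapeIdx n r k → ℝ) : Fam n k :=
  ∑ p, if cdeg r p.exponent p.1 = 0 then 0 else c p • famMonomial p.exponent p.1

/-- The part of `∑ c_p x^α dx_σ` in `𝒬_r⁻ Λ^k`, as a coefficient family. -/
def famQ {n r k : ℕ} (c : ShapeIdx n r k → ℝ) : Fam n k :=
  ∑ p, if cdeg r p.exponent p.1 = 0 then c p • famMonomial p.exponent p.1 else 0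

theorem famQ_add_famDK_famB {n r k : ℕ} (c : ShapeIdx n r k → ℝ) :
    famQ c + famDK n k (famB c) = ∑ p, c p • shapeFam p := by
  rw [famQ, famB, map_sum, ← Finset.sum_add_distrib]
  refine Finset.sum_congr rfl fun p _ => ?_
  unfold shapeFam
  split_ifs <;> simp

theorem isAlt_famB {n r k : ℕ} (c : ShapeIdx n r k → ℝ) : IsAlt (famB c) := by
  refine Finset.sum_induction _ IsAlt ?_ ⟨0, fun _ => rfl⟩ fun p _ => ?_
  · rintro U V ⟨A, hA⟩ ⟨A', hA'⟩
    exact ⟨A + A', fun f => by rw [Pi.add_apply, hA, hA', AlternatingMap.add_apply]⟩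
  · split_ifs
    · exact ⟨0, fun _ => rfl⟩
    · exact ⟨c p • (MvPolynomial.monomial (R := ℝ)
        (Finsupp.equivFunOnFinite.symm p.exponent)).compAlternatingMap (dx p.1).toAlternatingMap,
        fun _ => rfl⟩

open MvPolynomial in
theorem coeff_famMonomial {n k : ℕ} (α : Fin n → ℕ) (σ : Idx n k) (f : Fin k → Fin n)
    (β : Fin n →₀ ℕ) :
    coeff β (famMonomial α σ f) = if α = β then dx σ (basisTuple f) else 0 := by
  rw [famMonomial, coeff_monomial]
  refine if_congr ?_ rfl rfl
  rw [Equiv.symm_apply_eq]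
  rfl

-- A nonzero value of `dx_σ` on the tuple of `f` forces `f` and `σ` to have the same range, which
-- transfers the degree condition from `σ` to `f`.
open MvPolynomial in
theorem coeff_famB_ne_zero {n r k : ℕ} {c : ShapeIdx n r k → ℝ} {f : Fin k → Fin n}
    {β : Fin n →₀ ℕ} (h : coeff β (famB c f) ≠ 0) : (∀ i, β i ≤ r) ∧ ∃ i, β (f i) = r := by
  rw [famB, Finset.sum_apply, coeff_sum] at h
  obtain ⟨p, -, hp⟩ := Finset.exists_ne_zero_of_sum_ne_zero h
  split_ifs at hp with hc
  · simp at hp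
  · rw [Pi.smul_apply, coeff_smul, coeff_famMonomial] at hp
    split_ifs at hp with he
    · rw [cdeg_eq_zero_iff] at hc
      push Not at hc
      obtain ⟨j, hj⟩ := hc
      rw [he] at hj
      refine ⟨fun i => ?_, ?_⟩
      · rw [← he]
        exact Nat.lt_succ_iff.1 (p.2 i).2
      · have hr := range_eq_of_dx_basisTuple_ne_zero (right_ne_zero_of_mul hp)
        obtain ⟨i, hi⟩ : p.1 j ∈ Set.range f := hr ▸ ⟨j, rfl⟩
        exact ⟨i, by rw [hi, hj]⟩
    · simp at hp

open MvPolynomial in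
theorem coeff_famQ_ne_zero {n r k : ℕ} {c : ShapeIdx n r k → ℝ} {f : Fin k → Fin n}
    {β : Fin n →₀ ℕ} (h : coeff β (famQ c f) ≠ 0) : (∀ i, β i ≤ r) ∧ ∀ i, β (f i) ≠ r := by
  rw [famQ, Finset.sum_apply, coeff_sum] at h
  obtain ⟨p, -, hp⟩ := Finset.exists_ne_zero_of_sum_ne_zero h
  split_ifs at hp with hc
  · rw [Pi.smul_apply, coeff_smul, coeff_famMonomial] at hp
    split_ifs at hp with he
    · rw [cdeg_eq_zero_iff] at hc
      refine ⟨fun i => ?_, fun i => ?_⟩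
      · rw [← he]
        exact Nat.lt_succ_iff.1 (p.2 i).2
      · have hr := range_eq_of_dx_basisTuple_ne_zero (right_ne_zero_of_mul hp)
        obtain ⟨j, hj⟩ : f i ∈ Set.range p.1 := hr ▸ ⟨i, rfl⟩
        rw [← hj, ← he]
        exact hc j
    · simp at hp
  · simp at hp

open MvPolynomial in
theorem coeff_famQ_add_famB {n r k : ℕ} (c : ShapeIdx n r k → ℝ) (p : ShapeIdx n r k) :
    coeff (Finsupp.equivFunOnFinite.symm p.exponent) ((famQ c + famB c) p.1) = c p := by
  have h : famQ c + famB c = ∑ q, c q • famMonomial q.exponent q.1 := by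
    rw [famQ, famB, ← Finset.sum_add_distrib]
    refine Finset.sum_congr rfl fun q _ => ?_
    split_ifs <;> simp
  rw [h, Finset.sum_apply, coeff_sum, Finset.sum_eq_single p]
  · rw [Pi.smul_apply, coeff_smul, coeff_famMonomial, dx_basisTuple_self]
    simp
  · intro q _ hq
    rw [Pi.smul_apply, coeff_smul, coeff_famMonomial]
    split_ifs with he
    · have h2 : q.2 = p.2 := funext fun i => Fin.ext (congrFun he i)
      rw [dx_basisTuple_of_ne fun h1 => hq (Prod.ext h1 h2), smul_zero]
    · exact smul_zero _
  · simp

/-! ### Linear independence on the grid -/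

open MvPolynomial in
/-- A polynomial of total degree at most `d` that vanishes on a grid `S^n` with `r < |S|` has no
monomials of total degree `d` and partial degrees at most `r`. -/
theorem coeff_eq_zero_of_eval_grid {n r d : ℕ} {F : MvPolynomial (Fin n) ℝ} {S : Finset ℝ}
    (hS : r < S.card) (hd : F.totalDegree ≤ d) (h : ∀ x : Fin n → ℝ, (∀ i, x i ∈ S) → eval x F = 0)
    {β : Fin n →₀ ℕ} (hβ : ∀ i, β i ≤ r) (hβd : β.degree = d) : coeff β F = 0 := by
  by_contra hne
  have hle : β.degree ≤ F.totalDegree := by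
    have := le_totalDegree (mem_support_iff.2 hne)
    rwa [Finsupp.degree_eq_sum, ← Finsupp.sum_fintype _ (fun _ e => e) (by simp)]
  obtain ⟨x, hx, hx'⟩ := combinatorial_nullstellensatz_exists_eval_nonzero F β hne
    (le_antisymm (hβd ▸ hd) hle) (fun _ => S) fun i => (hβ i).trans_lt hS
  exact hx' (h x hx)

open MvPolynomial in
/-- The shape functions are linearly independent on the grid. -/
theorem eq_zero_of_sum_shapeFam_eval {n r k : ℕ} {S : Finset ℝ} (hS : r < S.card)
    {c : ShapeIdx n r k → ℝ}
    (h : ∀ f, ∀ x : Fin n → ℝ, (∀ i, x i ∈ S) → eval x ((∑ p, c p • shapeFam p) f) = 0) :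
    c = 0 := by
  by_contra hc
  have hne : (Finset.univ.filter fun p => c p ≠ 0).Nonempty := by
    obtain ⟨p, hp⟩ := Function.ne_iff.1 hc
    exact ⟨p, by simpa using hp⟩
  obtain ⟨p₀, hp₀, hmax⟩ := Finset.exists_max_image _ (fun p => ∑ i, p.exponent i) hne
  replace hp₀ : c p₀ ≠ 0 := (Finset.mem_filter.1 hp₀).2
  replace hmax : ∀ p, c p ≠ 0 → ∑ i, p.exponent i ≤ ∑ i, p₀.exponent i :=
    fun p hp => hmax p (by simpa using hp)
  set d := ∑ i, p₀.exponent i with hd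
  -- Only the coefficients of top degree `d` are kept; the Nullstellensatz gives no information on
  -- lower ones.
  let c' : ShapeIdx n r k → ℝ := fun p => if ∑ i, p.exponent i = d then c p else 0
  have hdeg : ∀ f, ((∑ p, c p • shapeFam p) f).totalDegree ≤ d := by
    intro f
    rw [Finset.sum_apply]
    refine totalDegree_finsetSum_le fun p _ => ?_
    by_cases hp : c p = 0
    · simp [hp]
    · exact (totalDegree_smul_le _ _).trans
        ((isHomogeneous_shapeFam p f).totalDegree_le.trans (hmax p hp))
  have hcoeff : ∀ f β, (∀ i, β i ≤ r) → coeff β (famQ c' f + famDK n k (famB c') f) = 0 := by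
    intro f β hβ
    rw [← Pi.add_apply, famQ_add_famDK_famB]
    -- In degree `d` the coefficients for `c` and `c'` agree by homogeneity; in other degrees those
    -- for `c'` vanish.
    by_cases hβd : β.degree = d
    · rw [← coeff_eq_zero_of_eval_grid hS (hdeg f) (h f) hβ hβd]
      simp only [Finset.sum_apply, coeff_sum, Pi.smul_apply, coeff_smul]
      refine Finset.sum_congr rfl fun p _ => ?_
      by_cases hp : ∑ i, p.exponent i = d
      · simp [c', hp]
      · rw [(isHomogeneous_shapeFam p f).coeff_eq_zero (fun e => hp (e.symm.trans hβd)),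
          smul_zero, smul_zero]
    · simp only [Finset.sum_apply, coeff_sum, Pi.smul_apply, coeff_smul]
      refine Finset.sum_eq_zero fun p _ => ?_
      by_cases hp : ∑ i, p.exponent i = d
      · rw [(isHomogeneous_shapeFam p f).coeff_eq_zero (fun e => hβd (e.trans hp)), smul_zero]
      · simp [c', hp]
  obtain ⟨hB, hQ⟩ := eq_zero_of_coeff_add_famDK_eq_zero (isAlt_famB c')
    (fun _ _ => coeff_famB_ne_zero) (fun _ _ => coeff_famQ_ne_zero) hcoeff
  replace hQ : famQ c' = 0 := hQ
  have h0 := coeff_famQ_add_famB c' p₀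
  rw [hB, hQ] at h0
  exact hp₀ (by simpa [c', hd] using h0.symm)

/-! ### Unisolvence by dimension count -/

/-- The combination `∑ c_p u_p` of the shape functions, restricted to the cube. -/
def shapeMap (n r k : ℕ) : (ShapeIdx n r k → ℝ) →ₗ[ℝ] (cube n → Alt n k) :=
  LinearMap.funLeft ℝ (Alt n k) (Subtype.val : cube n → Fin n → ℝ) ∘ₗ
    Fintype.linearCombination ℝ shapeForm

theorem range_shapeMap (n r k : ℕ) : LinearMap.range (shapeMap n r k) = QTildeCube n r k := by
  rw [shapeMap, LinearMap.range_comp, Fintype.range_linearCombination, QTildeCube, QTilde_eq_span]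

theorem nodalEval_shapeMap_injective {n r k : ℕ} (hr : 1 ≤ r) :
    Function.Injective (nodalEval n r k ∘ₗ shapeMap n r k) := by
  rw [injective_iff_map_eq_zero]
  intro c hc
  obtain ⟨S, hS, hS'⟩ := exists_finset_gaussLobattoNodes hr
  refine eq_zero_of_sum_shapeFam_eval (S := S) (by lia) fun f x hx => ?_
  have hx' : ∀ i, x i ∈ gaussLobattoNodes r := fun i => hS' ▸ hx i
  have hrep : ∀ g, (∑ p, c p • shapeForm p x) (basisTuple g) =
      MvPolynomial.eval x ((∑ p, c p • shapeFam p) g) := by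
    intro g
    simp [ContinuousAlternatingMap.sum_apply, Finset.sum_apply, represents_shapeForm _ x,
      MvPolynomial.smul_eval]
  rw [← hrep]
  -- The nodal data concern increasing tuples only; alternation extends the vanishing to all tuples.
  refine apply_basisTuple_eq_zero (fun σ => ?_) f
  have h : shapeMap n r k c ⟨x, fun i => gaussLobattoNodes_subset_Icc r (hx' i)⟩
      (basisTuple σ) = 0 := congrFun (congrFun hc σ) ⟨⟨x, _⟩, hx'⟩
  simpa [shapeMap, Fintype.linearCombination_apply, LinearMap.funLeft_apply] using h

theorem nodalEval_shapeMap_bijective {n r k : ℕ} (hr : 1 ≤ r) :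
    Function.Bijective (nodalEval n r k ∘ₗ shapeMap n r k) := by
  have hinj := nodalEval_shapeMap_injective (n := n) (k := k) hr
  have := finite_grid (n := n) hr
  have := Fintype.ofFinite (grid n r)
  refine ⟨hinj, (LinearMap.injective_iff_surjective_of_finrank_eq_finrank ?_).1 hinj⟩
  have hcard : Fintype.card (grid n r) = (r + 1) ^ n := by
    rw [← Nat.card_eq_fintype_card, natCard_grid hr]
  rw [Module.finrank_fintype_fun_eq_card, Module.finrank_pi_fintype]
  simp [hcard]

end

end CubicalForms

theorem mainTheorem3 (n r k : ℕ) (hr : 1 ≤ r) (hk : k ≤ n) :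
    (∀ v ∈ CubicalForms.QTildeCube n r k, CubicalForms.nodalEval n r k v = 0 → v = 0) ∧
    (CubicalForms.grid n r).ncard = (r + 1) ^ n ∧
    Function.Bijective
      ((CubicalForms.nodalEval n r k).domRestrict (CubicalForms.QTildeCube n r k)) := by
  have hbij := CubicalForms.nodalEval_shapeMap_bijective (n := n) (k := k) hr
  have hzero : ∀ v ∈ CubicalForms.QTildeCube n r k,
      CubicalForms.nodalEval n r k v = 0 → v = 0 := by
    intro v hv h0
    rw [← CubicalForms.range_shapeMap] at hv
    obtain ⟨c, rfl⟩ := hv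
    have hc : c = 0 := hbij.1 (by rw [LinearMap.comp_apply, h0, map_zero])
    rw [hc, map_zero]
  refine ⟨hzero, ?_, ?_, ?_⟩
  · rw [← Nat.card_coe_set_eq, CubicalForms.natCard_grid hr]
  · rw [injective_iff_map_eq_zero]
    exact fun v hv => Subtype.ext (hzero v v.2 hv)
  · intro y
    obtain ⟨c, hc⟩ := hbij.2 y
    exact ⟨⟨CubicalForms.shapeMap n r k c,
      CubicalForms.range_shapeMap n r k ▸ LinearMap.mem_range_self _ c⟩, hc⟩
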